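/- Let $\mathscr W$ be the space of continuous $w:[0,1]\to\mathbb R$ with $w(0)=0$, with the topology of uniform convergence, its Borel $\sigma$-field and the Wiener measure $\gamma$ (expectation $E$), and let $\mathcal F_t=\sigma(w(u):0\le u\le t)$ be the natural filtration. Let $\mathscr H\subset\mathscr W$ be the Cameron–Martin space of absolutely continuous $h$ with $\dot h\in L^2[0,1]$. For $h\in\mathscr H$ let $[h](w)=\int_0^1\dot h(t)\,dw(t)$ be the Wiener integral, in the version $$[h](w)=\lim_{n\to\infty}\sum_{j=0}^{2^n-1}2^n\big(h(\tfrac{j+1}{2^n})-h(\tfrac j{2^n})\big)\big(w(\tfrac{j+1}{2^n})-w(\tfrac j{2^n})\big)$$ if the limit exists (which is so for almost all $w$), and $[h](w)=0$ otherwise; for step functions $\dot h$ with dyadic jump points this is the elementary integral, for every $w$. Let $\mathbf P$ be the set of functionals $F(w)=p([h_1](w),\dots,[h_n](w))$ with $n\in\mathbb N$, $h_i\in\mathscr H$ and $p$ a real polynomial, and let $\mathbf P_H\subset\mathbf P$ consist of those for which all $h_i$ can be taken such that $\dot h_i$ belongs to the Haar system of $L^2[0,1]$. For $\theta\in\mathscr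 H$ and $F:\mathscr W\to\mathbb R$ put $$D_\theta F(w)=\lim_{\varepsilon\to0}\tfrac1\varepsilon\{F(w+\varepsilon\theta)-F(w)\},\qquad D^*_\theta F=-D_\theta F+[\theta]\,F .$$ Fix an integer $s\ge0$ and, for $k=1,\dots,2^s$, an $\mathcal F_{(k-1)/2^s}$-measurable $z_k:\mathscr W\to\mathbb R$, and consider the simple predictable process $$z(w,t)=\sum_{k=1}^{2^s}2^{s/2}z_k(w)\,1_{(\frac{k-1}{2^s},\frac k{2^s}]}(t),$$ with $\int_0^1 z(w,t)\,dw(t)=\sum_{k=1}^{2^s}2^{s/2}z_k(w)\big(w(\tfrac k{2^s})-w(\tfrac{k-1}{2^s})\big)$. Let $\sigma_k(t)=2^{s/2}\int_0^t1_{(\frac{k-1}{2^s},\frac k{2^s}]}(u)\,du$ and $$D_{z_k}=z_kD_{\sigma_k},\quad D^*_{z_k}=z_kD^*_{\sigma_k},\quad e^{A}F(w)=\sum_{n=0}^\infty\tfrac1{n!}A^nF(w)\quad(A=D_{z_k}\text{ or }D^*_{z_k}).$$ $F$ is said to be in the domain of $e^{A}$ if all derivatives needed to form $A^nF$, $n\ge0$,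 exist at every $w$ and the series converges for every $w$. Then: (i) For $F\in\mathbf P_H$, all exponentials below are applied to functions in their domains, and for every $w\in\mathscr W$ $$e^{D_{z_{2^s}}}\cdots e^{D_{z_1}}F(w)=F\Big(w+\int_0^\cdot z(w,u)\,du\Big).$$ (ii) For $1\le k\le 2^s$ and every $\mathcal F_{(k-1)/2^s}$-measurable $F:\mathscr W\to\mathbb R$, $F$ is in the domain of $e^{D^*_{z_k}}$ and $e^{D^*_{z_k}}F=F\cdot e^{D^*_{z_k}}(1)$ everywhere. Moreover all exponentials below are applied to functions in their domains, and for every $w\in\mathscr W$ $$e^{D^*_{z_{2^s}}}\cdots e^{D^*_{z_1}}(1)(w)=\exp\Big\{\int_0^1z(w,t)\,dw(t)-\frac12\int_0^1z(w,t)^2\,dt\Big\}.$$ (iii) Let $1\le k\le 2^s$, $F\in\mathbf P$, and let $G$ be integrable and $\mathcal F_{(k-1)/2^s}$-measurable. Then $F$ is in the domain of $e^{D_{z_k}}$, $G$ is in the domain of $e^{D^*_{z_k}}$, and $$E[e^{D_{z_k}}(F)\,G]=E[F\,e^{D^*_{z_k}}(G)]$$ in the following sense: the positive parts of the two integrands have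 the same expectation in $[0,\infty]$, and so have the negative parts; in particular one integrand is integrable if and only if the other is, and then the expectations are equal. -/

import Mathlib

open MeasureTheory ProbabilityTheory Filter Topology

noncomputable section

/-- Continuous real paths on `[0,1]` that start from zero. -/
def wienerSubmodule : Submodule ℝ C(unitInterval, ℝ) where
  carrier := {w | w 0 = 0}
  add_mem' := by
    intro a b ha hb
    simp_all
  zero_mem' := by simp
  smul_mem' := by
    intro c a ha
    simp_all

/-- The Wiener space `𝒲`, with the sup norm (uniform convergence). -/
abbrev WienerSpace : Type := wienerSubmodule

/-- The value `w(t)` of a path; only `t ∈ [0,1]` is relevant (the path is extended to `ℝ` by its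
end values). -/
def pathAt (w : WienerSpace) (t : ℝ) : ℝ :=
  Set.IccExtend (zero_le_one (α := ℝ)) (fun u => w.1 u) t

/-- `𝓑(𝒲)`: the Borel σ-field of the topology of uniform convergence. -/
instance instMeasurableSpaceWienerSpace : MeasurableSpace WienerSpace := borel _

instance instBorelSpaceWienerSpace : BorelSpace WienerSpace := ⟨rfl⟩

/-- `γ` is the Wiener measure: under `γ` the coordinate process (which starts from zero) has
independent increments, and `w(t) - w(s)` is centred Gaussian with variance `t - s`. -/
structure IsWienerMeasure (γ : Measure WienerSpace) : Prop where
  isProbabilityMeasure : IsProbabilityMeasure γ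
  indep : HasIndepIncrements (fun (t : unitInterval) (w : WienerSpace) => w.1 t) γ
  law : ∀ s t : unitInterval, s ≤ t →
    HasLaw (fun w : WienerSpace => w.1 t - w.1 s)
      (gaussianReal 0 (Real.toNNReal ((t : ℝ) - (s : ℝ)))) γ

/-- The natural filtration `𝓕_t = σ(w(u) : 0 ≤ u ≤ t)`. -/
abbrev pathFiltration (t : ℝ) : MeasurableSpace WienerSpace :=
  ⨆ u : unitInterval, ⨆ _ : (u : ℝ) ≤ t,
    MeasurableSpace.comap (fun w : WienerSpace => w.1 u) inferInstance

/-- The Cameron-Martin space `ℋ`: absolutely continuous paths with square integrable derivative. -/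
def cameronMartin : Set WienerSpace :=
  {h | AbsolutelyContinuousOnInterval (pathAt h) 0 1 ∧
    MemLp (deriv (pathAt h)) 2 (volume.restrict (Set.Icc (0 : ℝ) 1))}

/-- `∫₀¹ ḣₙ(t) dw(t)`, where `hₙ` is the piecewise linear interpolation of `h` at the points
`j / 2ⁿ`; its derivative `ḣₙ` is constant, equal to `2ⁿ (h((j+1)/2ⁿ) - h(j/2ⁿ))`, on the `j`-th
dyadic interval. -/
def dyadicSum (n : ℕ) (h w : WienerSpace) : ℝ :=
  ∑ j ∈ Finset.range (2 ^ n),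
    (2 : ℝ) ^ n * (pathAt h (((j : ℝ) + 1) / 2 ^ n) - pathAt h ((j : ℝ) / 2 ^ n)) *
      (pathAt w (((j : ℝ) + 1) / 2 ^ n) - pathAt w ((j : ℝ) / 2 ^ n))

open Classical in
/-- The Wiener integral `[h](w) = ∫₀¹ ḣ(t) dw(t)`, as a function defined at every path `w`: the
limit of `∫₀¹ ḣₙ dw` where it exists, and `0` elsewhere.  For `h ∈ ℋ` one has `hₙ → h` in `ℋ`, and
`∫₀¹ ḣₙ dw`, being the conditional expectation of `∫₀¹ ḣ dw` given `(w(j/2ⁿ))_j`, is an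
`L²`-bounded martingale in `n`; so the limit exists almost surely and in `L²` and is the Wiener
integral of `ḣ`.  The set of `w` where it exists is invariant under translations by elements of
`ℋ`.  If `ḣ` is a step function with dyadic jump points, the sequence is eventually constant, equal
to the elementary integral, for every `w`. -/
def wienerIntegral (h w : WienerSpace) : ℝ :=
  if H : ∃ l : ℝ, Tendsto (fun n => dyadicSum n h w) atTop (𝓝 l) then H.choose else 0

/-- Functionals `F(w) = p([h₁](w), …, [hₙ](w))` with `p` a real polynomial and `hᵢ ∈ S`. -/
def polynomialFunctionals (S : Set WienerSpace) : Set (WienerSpace → ℝ) :=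
  {F | ∃ (n : ℕ) (h : Fin n → WienerSpace) (p : MvPolynomial (Fin n) ℝ),
    (∀ i, h i ∈ S) ∧ ∀ w, F w = MvPolynomial.eval (fun i => wienerIntegral (h i) w) p}

/-- The path `t ↦ ∫₀ᵗ g(u) du`. -/
def primitive (g : ℝ → ℝ) (hg : Integrable g) : WienerSpace :=
  ⟨⟨fun t => ∫ u in (0 : ℝ)..(t : ℝ), g u,
    (intervalIntegral.continuous_primitive (fun _ _ => hg.intervalIntegrable) 0).comp
      continuous_subtype_val⟩, by
      show (∫ u in (0 : ℝ)..((0 : unitInterval) : ℝ), g u) = 0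
      simp⟩

/-- The indicator function of `(a, b]`. -/
def stepFun (a b : ℝ) : ℝ → ℝ := (Set.Ioc a b).indicator (fun _ => 1)

theorem integrable_stepFun (a b : ℝ) : Integrable (stepFun a b) :=
  (integrable_indicator_iff measurableSet_Ioc).2 (by simp)

/-- The Haar function `2^{n/2} (1_{((2k-2)/2^{n+1}, (2k-1)/2^{n+1}]} - 1_{((2k-1)/2^{n+1}, 2k/2^{n+1}]})`,
`1 ≤ k ≤ 2ⁿ`. -/
def haarFun (n k : ℕ) (t : ℝ) : ℝ :=
  (2 : ℝ) ^ ((n : ℝ) / 2) *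
    (stepFun ((2 * (k : ℝ) - 2) / 2 ^ (n + 1)) ((2 * (k : ℝ) - 1) / 2 ^ (n + 1)) t -
      stepFun ((2 * (k : ℝ) - 1) / 2 ^ (n + 1)) (2 * (k : ℝ) / 2 ^ (n + 1)) t)

theorem integrable_haarFun (n k : ℕ) : Integrable (haarFun n k) :=
  ((integrable_stepFun _ _).sub (integrable_stepFun _ _)).const_mul _

/-- The Haar system of `ℋ`: the primitives of `1` and of the Haar functions. -/
def haarSystem : Set WienerSpace :=
  {e | e = primitive (stepFun 0 1) (integrable_stepFun 0 1) ∨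
    ∃ n : ℕ, ∃ k ∈ Finset.Icc 1 (2 ^ n), e = primitive (haarFun n k) (integrable_haarFun n k)}

/-- `𝐏`: the polynomial functionals. -/
def polyP : Set (WienerSpace → ℝ) := polynomialFunctionals cameronMartin

/-- `𝐏_H`: the polynomials in the Wiener integrals of the Haar system. -/
def polyPH : Set (WienerSpace → ℝ) := polynomialFunctionals haarSystem

/-- `2^{s/2} 1_{((k-1)/2^s, k/2^s]}`. -/
def sigmaDot (s k : ℕ) (t : ℝ) : ℝ :=
  (2 : ℝ) ^ ((s : ℝ) / 2) * stepFun (((k : ℝ) - 1) / 2 ^ s) ((k : ℝ) / 2 ^ s) t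

theorem integrable_sigmaDot (s k : ℕ) : Integrable (sigmaDot s k) :=
  (integrable_stepFun _ _).const_mul _

/-- The direction `σ_k^s ∈ ℋ`, `1 ≤ k ≤ 2^s`. -/
def sigma (s k : ℕ) : WienerSpace := primitive (sigmaDot s k) (integrable_sigmaDot s k)

/-- `z = (z_k)_{1 ≤ k ≤ 2^s}` are the coefficients of a simple predictable process: `z_k` is
`𝓕_{(k-1)/2^s}`-measurable.  Only the indices `1 ≤ k ≤ 2^s` are used. -/
def IsSimplePredictable (s : ℕ) (z : ℕ → WienerSpace → ℝ) : Prop :=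
  ∀ k : ℕ, 1 ≤ k → k ≤ 2 ^ s → Measurable[pathFiltration (((k : ℝ) - 1) / 2 ^ s)] (z k)

/-- The process `z(w,t) = ∑_{k=1}^{2^s} 2^{s/2} z_k(w) 1_{((k-1)/2^s, k/2^s]}(t)`. -/
def simpleProcess (s : ℕ) (z : ℕ → WienerSpace → ℝ) (w : WienerSpace) (t : ℝ) : ℝ :=
  ∑ k ∈ Finset.Icc 1 (2 ^ s),
    (2 : ℝ) ^ ((s : ℝ) / 2) * z k w * stepFun (((k : ℝ) - 1) / 2 ^ s) ((k : ℝ) / 2 ^ s) t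

theorem integrable_simpleProcess (s : ℕ) (z : ℕ → WienerSpace → ℝ) (w : WienerSpace) :
    Integrable (simpleProcess s z w) :=
  integrable_finsetSum _ fun _ _ => (integrable_stepFun _ _).const_mul _

/-- The path `∫₀^· z(w,u) du`. -/
def drift (s : ℕ) (z : ℕ → WienerSpace → ℝ) (w : WienerSpace) : WienerSpace :=
  primitive (simpleProcess s z w) (integrable_simpleProcess s z w)

/-- The stochastic integral `∫₀¹ z(w,t) dw(t)` of the simple process. -/
def stochasticIntegral (s : ℕ) (z : ℕ → WienerSpace → ℝ) (w : WienerSpace) : ℝ :=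
  ∑ k ∈ Finset.Icc 1 (2 ^ s), (2 : ℝ) ^ ((s : ℝ) / 2) * z k w *
    (pathAt w ((k : ℝ) / 2 ^ s) - pathAt w (((k : ℝ) - 1) / 2 ^ s))

/-- `F` has a derivative in the direction `θ` at every path. -/
def DirDifferentiable (θ : WienerSpace) (F : WienerSpace → ℝ) : Prop :=
  ∀ w, DifferentiableAt ℝ (fun ε : ℝ => F (w + ε • θ)) 0

/-- `D_θ F(w) = lim_{ε → 0} (F(w + εθ) - F(w)) / ε`. -/
def dirDeriv (θ : WienerSpace) (F : WienerSpace → ℝ) : WienerSpace → ℝ :=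
  fun w => deriv (fun ε : ℝ => F (w + ε • θ)) 0

/-- `D_θ^* F = -D_θ F + [θ] F`. -/
def dirAdjoint (θ : WienerSpace) (F : WienerSpace → ℝ) : WienerSpace → ℝ :=
  fun w => -dirDeriv θ F w + wienerIntegral θ w * F w

/-- `D_{z_k} = z_k D_{σ_k}`. -/
def opD (s : ℕ) (z : ℕ → WienerSpace → ℝ) (k : ℕ) (F : WienerSpace → ℝ) : WienerSpace → ℝ :=
  fun w => z k w * dirDeriv (sigma s k) F w

/-- `D_{z_k}^* = z_k D_{σ_k}^*`. -/
def opDstar (s : ℕ) (z : ℕ → WienerSpace → ℝ) (k : ℕ) (F : WienerSpace → ℝ) : WienerSpace → ℝ :=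
  fun w => z k w * dirAdjoint (sigma s k) F w

/-- The exponential `e^A F(w) = ∑_{n ≥ 0} (Aⁿ F)(w) / n!`. -/
def expOp (A : (WienerSpace → ℝ) → WienerSpace → ℝ) (F : WienerSpace → ℝ) : WienerSpace → ℝ :=
  fun w => ∑' n : ℕ, (A^[n] F) w / (n.factorial : ℝ)

/-- `F` is in the domain of `e^A`, where `A` involves the derivative in the direction `θ`: all the
derivatives needed to form `Aⁿ F` exist everywhere, and the exponential series converges
(absolutely) at every path. -/
def InExpDomain (θ : WienerSpace) (A : (WienerSpace → ℝ) → WienerSpace → ℝ)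
    (F : WienerSpace → ℝ) : Prop :=
  (∀ n : ℕ, DirDifferentiable θ (A^[n] F)) ∧
    ∀ w, Summable fun n : ℕ => (A^[n] F) w / (n.factorial : ℝ)

/-- `e^{D_{z_m}} ⋯ e^{D_{z_1}} F`. -/
def expChain (s : ℕ) (z : ℕ → WienerSpace → ℝ) (F : WienerSpace → ℝ) : ℕ → WienerSpace → ℝ
  | 0 => F
  | m + 1 => expOp (opD s z (m + 1)) (expChain s z F m)

/-- `e^{D_{z_m}^*} ⋯ e^{D_{z_1}^*} F`. -/
def expStarChain (s : ℕ) (z : ℕ → WienerSpace → ℝ) (F : WienerSpace → ℝ) : ℕ → WienerSpace → ℝ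
  | 0 => F
  | m + 1 => expOp (opDstar s z (m + 1)) (expStarChain s z F m)

end

/-! ### Paths and dyadic steps -/

/-! Everything reduces to calculus on a single line `w + ε • sigma s k`. The path `sigma s k`
vanishes up to time `(k-1)/2^s`, and a functional measurable with respect to `pathFiltration` at
that time sees only the path up to then. Hence `z k` is constant along such lines and commutes with
the derivative, so the powers of `D_{z_k}` and `D*_{z_k}` are `z_k ^ n` times those of the
derivative and its adjoint.

Along a line every Wiener integral is affine in `ε`, so a polynomial functional is a polynomial in
`ε`; its finite Taylor expansion makes `e^{D_{z_k}}` the translation by `z_k σ_k` (`expOp_opD`).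
Later translations leave earlier coefficients unchanged, so the translations add up to the drift
(`expChain_eq`).

On functionals constant along the line, iterating the adjoint reproduces the Hermite recursion
`He_{n+1} = x He_n - He_n'`, so the series is the Hermite generating function `exp (y x - y² / 2)`
at `x = [σ_k]`, `y = z_k` (`expOp_opDstar`). The product of these factors is the Girsanov density
(`expStarChain_eq`).

Given these formulas, duality is Girsanov's theorem in one direction (`lintegral_add_smul_sigma`):
`[σ_k]` is standard Gaussian and independent of `w - [σ_k](w) σ_k`, on which `z_k` depends, so it
comes down to shifting a real Gaussian variable. Working with nonnegative integrals, for positive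
and negative parts separately, avoids any integrability assumption. -/

theorem pathAt_coe (w : WienerSpace) (t : unitInterval) : pathAt w t = w.1 t :=
  Set.IccExtend_val _ _ t

theorem pathAt_add_smul (w θ : WienerSpace) (ε t : ℝ) :
    pathAt (w + ε • θ) t = pathAt w t + ε * pathAt θ t := rfl

theorem integral_stepFun {a b t : ℝ} (ha : 0 ≤ a) (hab : a ≤ b) (ht : 0 ≤ t) :
    ∫ u in (0 : ℝ)..t, stepFun a b u = min b t - min a t := by
  rw [intervalIntegral.integral_of_le ht, stepFun, setIntegral_indicator measurableSet_Ioc,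
    Set.Ioc_inter_Ioc]
  simp only [integral_const, MeasurableSet.univ, measureReal_restrict_apply, Set.univ_inter,
    smul_eq_mul, mul_one, Real.volume_real_Ioc]
  grind

theorem pathAt_primitive (g : ℝ → ℝ) (hg : Integrable g) {t : ℝ} (ht : t ∈ Set.Icc (0 : ℝ) 1) :
    pathAt (primitive g hg) t = ∫ u in (0 : ℝ)..t, g u :=
  pathAt_coe (primitive g hg) ⟨t, ht⟩

theorem dyadic_left_nonneg {s k : ℕ} (hk : 1 ≤ k) : 0 ≤ ((k : ℝ) - 1) / 2 ^ s := by
  have : (1 : ℝ) ≤ k := by exact_mod_cast hk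
  exact div_nonneg (by linarith) (by positivity)

theorem dyadic_le (s k : ℕ) : ((k : ℝ) - 1) / 2 ^ s ≤ (k : ℝ) / 2 ^ s := by
  gcongr
  linarith

theorem dyadic_right_le_one {s k : ℕ} (hk : k ≤ 2 ^ s) : (k : ℝ) / 2 ^ s ≤ 1 := by
  rw [div_le_one (by positivity)]
  exact_mod_cast hk

theorem sqrt_two_pow_sq (s : ℕ) : (2 : ℝ) ^ ((s : ℝ) / 2) * (2 : ℝ) ^ ((s : ℝ) / 2) = 2 ^ s := by
  rw [← Real.rpow_add two_pos, add_halves, Real.rpow_natCast]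

theorem pathAt_sigma {s k : ℕ} (hk : 1 ≤ k) {t : ℝ} (ht : t ∈ Set.Icc (0 : ℝ) 1) :
    pathAt (sigma s k) t =
      (2 : ℝ) ^ ((s : ℝ) / 2) * (min ((k : ℝ) / 2 ^ s) t - min (((k : ℝ) - 1) / 2 ^ s) t) := by
  rw [sigma, pathAt_primitive _ _ ht]
  simp only [sigmaDot]
  rw [intervalIntegral.integral_const_mul,
    integral_stepFun (dyadic_left_nonneg hk) (dyadic_le s k) ht.1]

theorem sigma_eq_zero {s k : ℕ} (hk : 1 ≤ k) (u : unitInterval)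
    (hu : (u : ℝ) ≤ ((k : ℝ) - 1) / 2 ^ s) : (sigma s k).1 u = 0 := by
  rw [← pathAt_coe, pathAt_sigma hk u.2, min_eq_right hu, min_eq_right (hu.trans (dyadic_le s k)),
    sub_self, mul_zero]

/-! ### Wiener integrals along the directions `sigma s k` -/

theorem dyadicSum_add_smul (n : ℕ) (h w θ : WienerSpace) (ε : ℝ) :
    dyadicSum n h (w + ε • θ) = dyadicSum n h w + ε * dyadicSum n h θ := by
  simp only [dyadicSum, pathAt_add_smul, Finset.mul_sum, ← Finset.sum_add_distrib]
  exact Finset.sum_congr rfl fun _ _ => by ring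

theorem dyadicSum_comm (n : ℕ) (h w : WienerSpace) : dyadicSum n h w = dyadicSum n w h :=
  Finset.sum_congr rfl fun _ _ => by ring

/-- With endpoints on the grid, each cell lies inside or outside the interval; after clearing `N`
this is a statement about integers. -/
theorem min_sub_min_step (A B j : ℕ) (hAB : A ≤ B) (N : ℝ) (hN : 0 < N) :
    min ((B : ℝ) / N) (((j : ℝ) + 1) / N) - min ((A : ℝ) / N) (((j : ℝ) + 1) / N)
      - (min ((B : ℝ) / N) ((j : ℝ) / N) - min ((A : ℝ) / N) ((j : ℝ) / N))
      = if j ∈ Finset.Ico A B then 1 / N else 0 := by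
  simp only [min_div_div_right hN.le, ← sub_div]
  have h : (min (B : ℝ) ((j : ℝ) + 1) - min (A : ℝ) ((j : ℝ) + 1)
      - (min (B : ℝ) (j : ℝ) - min (A : ℝ) (j : ℝ))) = if j ∈ Finset.Ico A B then 1 else 0 := by
    have : ((min (B : ℤ) ((j : ℤ) + 1) - min (A : ℤ) ((j : ℤ) + 1)
      - (min (B : ℤ) (j : ℤ) - min (A : ℤ) (j : ℤ)))) = if j ∈ Finset.Ico A B then 1 else 0 := by
      simp only [Finset.mem_Ico]
      split_ifs <;> omega
    exact_mod_cast congrArg (Int.cast : ℤ → ℝ) this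
  rw [h]
  split_ifs <;> simp

/-- For `n ≥ s` the grid contains both jump points of the step function, so the sum telescopes over
the cells inside the step, whatever the path. -/
theorem dyadicSum_sigma {s k n : ℕ} (hk : 1 ≤ k) (hk' : k ≤ 2 ^ s) (hn : s ≤ n)
    (w : WienerSpace) :
    dyadicSum n (sigma s k) w = (2 : ℝ) ^ ((s : ℝ) / 2) *
      (pathAt w ((k : ℝ) / 2 ^ s) - pathAt w (((k : ℝ) - 1) / 2 ^ s)) := by
  obtain ⟨m, rfl⟩ := Nat.exists_eq_add_of_le hn
  obtain ⟨l, rfl⟩ := Nat.exists_eq_add_of_le' hk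
  -- Both endpoints of the step are rewritten as points of the finer grid of mesh `2^{-(s+m)}`.
  have hB : (((l + 1 : ℕ) : ℝ)) / 2 ^ s = (((l + 1) * 2 ^ m : ℕ) : ℝ) / 2 ^ (s + m) := by
    push_cast; rw [pow_add]; field_simp
  have hA : ((((l + 1 : ℕ) : ℝ)) - 1) / 2 ^ s = ((l * 2 ^ m : ℕ) : ℝ) / 2 ^ (s + m) := by
    push_cast; rw [pow_add]; field_simp; ring
  have hle : l * 2 ^ m ≤ (l + 1) * 2 ^ m := Nat.mul_le_mul_right _ (Nat.le_succ l)
  have hsub : Finset.Ico (l * 2 ^ m) ((l + 1) * 2 ^ m) ⊆ Finset.range (2 ^ (s + m)) := by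
    intro j hj
    have := (Finset.mem_Ico.1 hj).2
    have h2 : (l + 1) * 2 ^ m ≤ 2 ^ s * 2 ^ m := Nat.mul_le_mul_right _ hk'
    rw [Finset.mem_range, pow_add]
    omega
  have key : ∀ j ∈ Finset.range (2 ^ (s + m)),
      (2 : ℝ) ^ (s + m) * (pathAt (sigma s (l + 1)) (((j : ℝ) + 1) / 2 ^ (s + m))
        - pathAt (sigma s (l + 1)) ((j : ℝ) / 2 ^ (s + m)))
        * (pathAt w (((j : ℝ) + 1) / 2 ^ (s + m)) - pathAt w ((j : ℝ) / 2 ^ (s + m)))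
      = if j ∈ Finset.Ico (l * 2 ^ m) ((l + 1) * 2 ^ m) then (2 : ℝ) ^ ((s : ℝ) / 2) *
        (pathAt w (((j + 1 : ℕ) : ℝ) / 2 ^ (s + m)) - pathAt w ((j : ℝ) / 2 ^ (s + m))) else 0 := by
    intro j hj
    have hj1 : ((j : ℝ) + 1) ≤ 2 ^ (s + m) := by exact_mod_cast Finset.mem_range.1 hj
    have hp : (0 : ℝ) < 2 ^ (s + m) := by positivity
    have h1 : ((j : ℝ) + 1) / 2 ^ (s + m) ∈ Set.Icc (0 : ℝ) 1 :=
      ⟨by positivity, (div_le_one hp).2 hj1⟩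
    have h0 : (j : ℝ) / 2 ^ (s + m) ∈ Set.Icc (0 : ℝ) 1 :=
      ⟨by positivity, (div_le_one hp).2 (by linarith)⟩
    rw [pathAt_sigma hk h1, pathAt_sigma hk h0, hA, hB, ← mul_sub, min_sub_min_step _ _ _ hle _ hp]
    split_ifs
    · push_cast
      field_simp
    · simp
  rw [dyadicSum, Finset.sum_congr rfl key, ← Finset.sum_filter,
    Finset.filter_mem_eq_inter, Finset.inter_eq_right.2 hsub, ← Finset.mul_sum,
    Finset.sum_Ico_eq_sum_range, hA, hB]
  have hT := Finset.sum_range_sub (fun i : ℕ =>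
    pathAt w (((l * 2 ^ m + i : ℕ) : ℝ) / 2 ^ (s + m))) ((l + 1) * 2 ^ m - l * 2 ^ m)
  rw [Nat.add_sub_cancel' hle, add_zero] at hT
  rw [← hT]
  rfl

theorem wienerIntegral_eq_of_tendsto {h w : WienerSpace} {l : ℝ}
    (H : Tendsto (fun n => dyadicSum n h w) atTop (𝓝 l)) : wienerIntegral h w = l := by
  have H' : ∃ l : ℝ, Tendsto (fun n => dyadicSum n h w) atTop (𝓝 l) := ⟨l, H⟩
  rw [wienerIntegral, dif_pos H']
  exact tendsto_nhds_unique H'.choose_spec H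

theorem wienerIntegral_sigma {s k : ℕ} (hk : 1 ≤ k) (hk' : k ≤ 2 ^ s) (w : WienerSpace) :
    wienerIntegral (sigma s k) w = (2 : ℝ) ^ ((s : ℝ) / 2) *
      (pathAt w ((k : ℝ) / 2 ^ s) - pathAt w (((k : ℝ) - 1) / 2 ^ s)) := by
  refine wienerIntegral_eq_of_tendsto (tendsto_const_nhds.congr' ?_)
  filter_upwards [eventually_ge_atTop s] with n hn using (dyadicSum_sigma hk hk' hn w).symm

/-- Whether the defining limit exists or not, `[h]` is affine on lines in the direction
`sigma s k`. -/
theorem exists_wienerIntegral_add_smul_sigma {s k : ℕ} (hk : 1 ≤ k) (hk' : k ≤ 2 ^ s)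
    (h w : WienerSpace) :
    ∃ c : ℝ, ∀ ε : ℝ, wienerIntegral h (w + ε • sigma s k) = wienerIntegral h w + ε * c := by
  -- The dyadic sum is symmetric in its two arguments, so this sequence too is eventually constant.
  have hσ : Tendsto (fun n => dyadicSum n h (sigma s k)) atTop
      (𝓝 (wienerIntegral (sigma s k) h)) := by
    refine tendsto_const_nhds.congr' ?_
    filter_upwards [eventually_ge_atTop s] with n hn
    rw [dyadicSum_comm, dyadicSum_sigma hk hk' hn, wienerIntegral_sigma hk hk']
  by_cases H : ∃ l : ℝ, Tendsto (fun n => dyadicSum n h w) atTop (𝓝 l)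
  · obtain ⟨l, hl⟩ := H
    refine ⟨wienerIntegral (sigma s k) h, fun ε => ?_⟩
    rw [wienerIntegral_eq_of_tendsto hl]
    refine wienerIntegral_eq_of_tendsto ?_
    simp only [dyadicSum_add_smul]
    exact hl.add (hσ.const_mul ε)
  -- Translation along `sigma s k` preserves divergence, so the default value `0` is taken on the
  -- whole line.
  · refine ⟨0, fun ε => ?_⟩
    have H' : ¬ ∃ l : ℝ, Tendsto (fun n => dyadicSum n h (w + ε • sigma s k)) atTop (𝓝 l) := by
      rintro ⟨l, hl⟩
      refine H ⟨_, (hl.sub (hσ.const_mul ε)).congr fun n => ?_⟩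
      rw [dyadicSum_add_smul, add_sub_cancel_right]
    rw [wienerIntegral, dif_neg H', wienerIntegral, dif_neg H]
    simp

theorem pathAt_left_sigma {s k : ℕ} (hk : 1 ≤ k) (hk' : k ≤ 2 ^ s) :
    pathAt (sigma s k) (((k : ℝ) - 1) / 2 ^ s) = 0 := by
  have h0 := dyadic_left_nonneg (s := s) hk
  have h1 := dyadic_le s k
  rw [pathAt_sigma hk ⟨h0, h1.trans (dyadic_right_le_one hk')⟩, min_eq_right h1, min_self,
    sub_self, mul_zero]

theorem pathAt_right_sigma {s k : ℕ} (hk : 1 ≤ k) (hk' : k ≤ 2 ^ s) :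
    pathAt (sigma s k) ((k : ℝ) / 2 ^ s) = (2 : ℝ) ^ ((s : ℝ) / 2) / 2 ^ s := by
  have h0 := dyadic_left_nonneg (s := s) hk
  have h1 := dyadic_le s k
  rw [pathAt_sigma hk ⟨h0.trans h1, dyadic_right_le_one hk'⟩, min_eq_left h1, min_self]
  ring

theorem wienerIntegral_sigma_add_smul {s k : ℕ} (hk : 1 ≤ k) (hk' : k ≤ 2 ^ s)
    (w : WienerSpace) (ε : ℝ) :
    wienerIntegral (sigma s k) (w + ε • sigma s k) = wienerIntegral (sigma s k) w + ε := by
  rw [wienerIntegral_sigma hk hk', wienerIntegral_sigma hk hk', pathAt_add_smul, pathAt_add_smul,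
    pathAt_left_sigma hk hk', pathAt_right_sigma hk hk']
  have := sqrt_two_pow_sq s
  have h2 : (2 : ℝ) ^ s ≠ 0 := by positivity
  field_simp
  linear_combination ε * this

/-- `F` is a polynomial on every line in the direction `θ`. -/
def PolynomialAlong (θ : WienerSpace) (F : WienerSpace → ℝ) : Prop :=
  ∀ w, ∃ q : Polynomial ℝ, ∀ ε : ℝ, F (w + ε • θ) = q.eval ε

theorem polynomialAlong_of_mem {S : Set WienerSpace} {F : WienerSpace → ℝ}
    (hF : F ∈ polynomialFunctionals S) {s k : ℕ} (hk : 1 ≤ k) (hk' : k ≤ 2 ^ s) :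
    PolynomialAlong (sigma s k) F := by
  obtain ⟨n, h, p, -, hp⟩ := hF
  intro w
  choose c hc using fun i => exists_wienerIntegral_add_smul_sigma hk hk' (h i) w
  refine ⟨MvPolynomial.aeval (fun i => Polynomial.C (wienerIntegral (h i) w)
    + Polynomial.X * Polynomial.C (c i)) p, fun ε => ?_⟩
  rw [hp, ← Polynomial.coe_evalRingHom, MvPolynomial.map_aeval]
  have hid : (Polynomial.evalRingHom ε).comp (algebraMap ℝ (Polynomial ℝ)) = RingHom.id ℝ := by
    ext r
    simp
  have hval : (fun i => wienerIntegral (h i) (w + ε • sigma s k)) = fun i =>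
      Polynomial.evalRingHom ε (Polynomial.C (wienerIntegral (h i) w)
        + Polynomial.X * Polynomial.C (c i)) := by
    funext i
    simp [hc]
    ring
  rw [hid, hval]
  rfl

/-! ### Adapted functionals -/

/-- `f` is invariant under translations along `θ`. -/
def InvariantAlong (θ : WienerSpace) (f : WienerSpace → ℝ) : Prop :=
  ∀ (w : WienerSpace) (ε : ℝ), f (w + ε • θ) = f w

/-- The filtration is coarser than the pullback of the discrete σ-field under restriction to `[0,
t]`, and a pullback cannot separate paths with equal restrictions. -/
theorem eq_of_measurable_pathFiltration {t : ℝ} {f : WienerSpace → ℝ}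
    (hf : Measurable[pathFiltration t] f) {w w' : WienerSpace}
    (h : ∀ u : unitInterval, (u : ℝ) ≤ t → w.1 u = w'.1 u) : f w = f w' := by
  have hle : pathFiltration t ≤ MeasurableSpace.comap
      (fun (w : WienerSpace) (u : {u : unitInterval // (u : ℝ) ≤ t}) => w.1 u) ⊤ := by
    refine iSup₂_le fun u hu => ?_
    rintro _ ⟨S, -, rfl⟩
    exact ⟨{g | g ⟨u, hu⟩ ∈ S}, trivial, rfl⟩
  obtain ⟨S, -, hS⟩ := hle _ (hf (measurableSet_singleton (f w)))
  have hw : w ∈ f ⁻¹' {f w} := rfl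
  have hww : (fun u : {u : unitInterval // (u : ℝ) ≤ t} => w.1 u.1) = fun u => w'.1 u.1 :=
    funext fun u => h u.1 u.2
  rw [← hS, Set.mem_preimage, hww, ← Set.mem_preimage (f := fun (w : WienerSpace)
    (u : {u : unitInterval // (u : ℝ) ≤ t}) => w.1 u), hS] at hw
  exact hw.symm

theorem pathFiltration_le (t : ℝ) : pathFiltration t ≤ instMeasurableSpaceWienerSpace := by
  refine iSup₂_le fun u _ => Measurable.comap_le ?_
  exact ((continuous_eval_const u).comp continuous_subtype_val).measurable

theorem invariantAlong_sigma {s k m : ℕ} (hk : 1 ≤ k) (hkm : k ≤ m) {f : WienerSpace → ℝ}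
    (hf : Measurable[pathFiltration (((k : ℝ) - 1) / 2 ^ s)] f) :
    InvariantAlong (sigma s m) f := by
  refine fun w ε => eq_of_measurable_pathFiltration hf fun u hu => ?_
  have hu' : (u : ℝ) ≤ ((m : ℝ) - 1) / 2 ^ s := hu.trans (by gcongr)
  show w.1 u + ε * (sigma s m).1 u = w.1 u
  rw [sigma_eq_zero (hk.trans hkm) u hu', mul_zero, add_zero]

/-! ### The exponential of a derivative -/

/-- Turns a directional derivative at any point of a line into an ordinary derivative in the line
parameter; this lets the iterates below be computed on the whole line, as induction requires. -/
theorem dirDeriv_add_smul (θ : WienerSpace) (F : WienerSpace → ℝ) (w : WienerSpace) (ε : ℝ) :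
    dirDeriv θ F (w + ε • θ) = deriv (fun δ : ℝ => F (w + δ • θ)) ε := by
  have h := deriv_comp_const_add (fun δ : ℝ => F (w + δ • θ)) ε 0
  simp only [add_smul, add_zero, ← add_assoc] at h
  exact h

/-- The `n`-th term of the series is `z_k ^ n` times the `n`-th coefficient of the polynomial
representing `F` on the line, so the series is a finite sum equal to that polynomial at `z_k`. -/
theorem expOp_opD {s k : ℕ} {z : ℕ → WienerSpace → ℝ} (hz : InvariantAlong (sigma s k) (z k))
    {F : WienerSpace → ℝ} (hF : PolynomialAlong (sigma s k) F) :
    InExpDomain (sigma s k) (opD s z k) F ∧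
      ∀ w, expOp (opD s z k) F w = F (w + z k w • sigma s k) := by
  choose q hq using hF
  have key : ∀ (n : ℕ) (w : WienerSpace) (ε : ℝ), ((opD s z k)^[n] F) (w + ε • sigma s k)
      = z k w ^ n * (Polynomial.derivative^[n] (q w)).eval ε := by
    intro n
    induction n with
    | zero => intro w ε; simp [hq]
    | succ n ih =>
      intro w ε
      rw [Function.iterate_succ_apply', Function.iterate_succ_apply', opD, hz, dirDeriv_add_smul]
      simp only [ih]
      rw [deriv_const_mul_field, Polynomial.deriv]
      ring
  have hsum : ∀ w, HasSum (fun n : ℕ => ((opD s z k)^[n] F) w / (n.factorial : ℝ))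
      (F (w + z k w • sigma s k)) := by
    intro w
    have hterm : ∀ n : ℕ, ((opD s z k)^[n] F) w / (n.factorial : ℝ)
        = (q w).coeff n * z k w ^ n := by
      intro n
      have h := key n w 0
      rw [zero_smul, add_zero] at h
      rw [h, ← Polynomial.coeff_zero_eq_eval_zero, Polynomial.coeff_iterate_derivative, zero_add,
        Nat.descFactorial_self, nsmul_eq_mul]
      have : (n.factorial : ℝ) ≠ 0 := by positivity
      field_simp
    simp only [hterm, hq, Polynomial.eval_eq_sum_range]
    refine hasSum_sum_of_ne_finset_zero fun n hn => ?_
    rw [Polynomial.coeff_eq_zero_of_natDegree_lt (by simpa using hn), zero_mul]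
  refine ⟨⟨fun n w => ?_, fun w => (hsum w).summable⟩, fun w => (hsum w).tsum_eq⟩
  simp only [key]
  fun_prop

/-! ### The exponential of an adjoint derivative -/

/-- Each differentiation applies the Hermite recursion at `x - u`. The variable is complex so that
convergence of the Taylor series follows from the function being entire. -/
theorem iteratedDeriv_cexp_hermite (x : ℂ) (n : ℕ) :
    iteratedDeriv n (fun u : ℂ => Complex.exp (x * u - u ^ 2 / 2)) = fun u =>
      Polynomial.aeval (x - u) (Polynomial.hermite n) * Complex.exp (x * u - u ^ 2 / 2) := by
  induction n with
  | zero => simp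
  | succ n ih =>
    rw [iteratedDeriv_succ, ih]
    funext u
    have h1 : HasDerivAt (fun u : ℂ => x * u - u ^ 2 / 2) (x - u) u := by
      have := ((hasDerivAt_id u).const_mul x).sub (((hasDerivAt_id u).pow 2).div_const 2)
      exact this.congr_deriv (by simp)
    have h2 : HasDerivAt (fun u : ℂ => Polynomial.aeval (x - u) (Polynomial.hermite n))
        (Polynomial.aeval (x - u) (Polynomial.derivative (Polynomial.hermite n)) * (-1)) u :=
      (Polynomial.hasDerivAt_aeval (Polynomial.hermite n) (x - u)).comp u
        ((hasDerivAt_id u).const_sub x)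
    refine (h2.mul h1.cexp).deriv.trans ?_
    rw [Polynomial.hermite_succ]
    simp only [map_sub, map_mul, Polynomial.aeval_X]
    ring

theorem hasSum_hermite (x y : ℝ) :
    HasSum (fun n : ℕ => y ^ n * Polynomial.aeval x (Polynomial.hermite n) / (n.factorial : ℝ))
      (Real.exp (y * x - y ^ 2 / 2)) := by
  have hd : Differentiable ℂ (fun u : ℂ => Complex.exp ((x : ℂ) * u - u ^ 2 / 2)) := by fun_prop
  have h := Complex.hasSum_taylorSeries_of_entire hd 0 (y : ℂ)
  simp only [iteratedDeriv_cexp_hermite, sub_zero] at h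
  rw [← Complex.hasSum_ofReal]
  have hv : ((Real.exp (y * x - y ^ 2 / 2) : ℝ) : ℂ) = Complex.exp ((x : ℂ) * y - (y : ℂ) ^ 2 / 2) := by
    push_cast
    rw [mul_comm (y : ℂ)]
  rw [hv]
  refine h.congr_fun fun n => ?_
  have : (Polynomial.aeval (x : ℂ) (Polynomial.hermite n))
      = ((Polynomial.aeval x (Polynomial.hermite n) : ℝ) : ℂ) :=
    Polynomial.aeval_algebraMap_apply ℂ x _
  rw [this]
  push_cast
  simp only [smul_eq_mul]
  simp
  ring

/-- Since `[σ_k]` grows at unit rate along `σ_k`, the adjoint acts on functions of `[σ_k]` as `x -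
d/dx`, which raises the Hermite degree by one. -/
theorem expOp_opDstar {s k : ℕ} (hk : 1 ≤ k) (hk' : k ≤ 2 ^ s) {z : ℕ → WienerSpace → ℝ}
    (hz : InvariantAlong (sigma s k) (z k))
    {F : WienerSpace → ℝ} (hF : InvariantAlong (sigma s k) F) :
    InExpDomain (sigma s k) (opDstar s z k) F ∧
      ∀ w, expOp (opDstar s z k) F w =
        F w * Real.exp (z k w * wienerIntegral (sigma s k) w - z k w ^ 2 / 2) := by
  have key : ∀ (n : ℕ) (w : WienerSpace) (ε : ℝ), ((opDstar s z k)^[n] F) (w + ε • sigma s k)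
      = F w * z k w ^ n *
        Polynomial.aeval (wienerIntegral (sigma s k) w + ε) (Polynomial.hermite n) := by
    intro n
    induction n with
    | zero => intro w ε; simp [hF w ε]
    | succ n ih =>
      intro w ε
      rw [Function.iterate_succ_apply', opDstar, hz, dirAdjoint, dirDeriv_add_smul, ih,
        wienerIntegral_sigma_add_smul hk hk']
      simp only [ih]
      rw [deriv_const_mul_field, deriv_comp_const_add
        (fun x : ℝ => Polynomial.aeval x (Polynomial.hermite n)), Polynomial.deriv_aeval,
        Polynomial.hermite_succ]
      simp only [map_sub, map_mul, Polynomial.aeval_X]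
      ring
  have hsum : ∀ w, HasSum (fun n : ℕ => ((opDstar s z k)^[n] F) w / (n.factorial : ℝ))
      (F w * Real.exp (z k w * wienerIntegral (sigma s k) w - z k w ^ 2 / 2)) := by
    intro w
    refine ((hasSum_hermite (wienerIntegral (sigma s k) w) (z k w)).mul_left (F w)).congr_fun ?_
    intro n
    have h := key n w 0
    rw [zero_smul, add_zero, add_zero] at h
    rw [h]
    ring
  refine ⟨⟨fun n w => ?_, fun w => (hsum w).summable⟩, fun w => (hsum w).tsum_eq⟩
  simp only [key]
  refine DifferentiableAt.const_mul ?_ _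
  exact (Polynomial.hermite n).differentiable_aeval.differentiableAt.comp (0 : ℝ)
    (differentiableAt_id.const_add _)

/-! ### Measurability -/

theorem continuous_eval_path (u : unitInterval) : Continuous fun w : WienerSpace => w.1 u :=
  (continuous_eval_const u).comp continuous_subtype_val

theorem measurable_pathAt (t : ℝ) : Measurable fun w : WienerSpace => pathAt w t :=
  (continuous_eval_path _).measurable

/-- A pointwise limit of the dyadic sums cut off to the measurable set where they converge. -/
theorem measurable_wienerIntegral (h : WienerSpace) : Measurable (wienerIntegral h) := by
  have hd : ∀ n, Measurable (dyadicSum n h) := fun n =>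
    Finset.measurable_fun_sum _ fun j _ =>
      ((measurable_pathAt _).sub (measurable_pathAt _)).const_mul _
  have hE : MeasurableSet {w | ∃ l : ℝ, Tendsto (fun n => dyadicSum n h w) atTop (𝓝 l)} :=
    measurableSet_exists_tendsto hd
  refine measurable_of_tendsto_metrizable (f := fun n =>
    Set.indicator {w | ∃ l : ℝ, Tendsto (fun n => dyadicSum n h w) atTop (𝓝 l)} (dyadicSum n h))
    (fun n => (hd n).indicator hE) (tendsto_pi_nhds.2 fun w => ?_)
  by_cases H : ∃ l : ℝ, Tendsto (fun n => dyadicSum n h w) atTop (𝓝 l)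
  · simp only [Set.indicator_of_mem (show w ∈ {w | ∃ l : ℝ,
      Tendsto (fun n => dyadicSum n h w) atTop (𝓝 l)} from H)]
    obtain ⟨l, hl⟩ := H
    rwa [wienerIntegral_eq_of_tendsto hl]
  · simp only [Set.indicator_of_notMem (show w ∉ {w | ∃ l : ℝ,
      Tendsto (fun n => dyadicSum n h w) atTop (𝓝 l)} from H)]
    rw [wienerIntegral, dif_neg H]
    exact tendsto_const_nhds

theorem measurable_of_mem_polynomialFunctionals {S : Set WienerSpace} {F : WienerSpace → ℝ}
    (hF : F ∈ polynomialFunctionals S) : Measurable F := by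
  obtain ⟨n, h, p, -, hp⟩ := hF
  rw [funext hp]
  exact p.continuous_eval.measurable.comp
    (measurable_pi_lambda _ fun i => measurable_wienerIntegral (h i))

instance instPolishSpaceWienerSpace : PolishSpace WienerSpace := by
  refine IsClosed.polishSpace (α := C(unitInterval, ℝ)) ?_
  exact isClosed_eq (continuous_eval_const (0 : unitInterval)) continuous_const

/-- The Borel sets of the Wiener space are generated by the coordinate maps. -/
theorem measurableEmbedding_eval :
    MeasurableEmbedding fun (w : WienerSpace) (n : ℕ) => w.1 (TopologicalSpace.denseSeq _ n) := by
  -- Lusin–Souslin: a continuous injection of a Polish space is a measurable embedding.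
  refine Continuous.measurableEmbedding (continuous_pi fun n => continuous_eval_path _) ?_
  intro w w' hw
  refine Subtype.ext (DFunLike.coe_injective ?_)
  refine Continuous.ext_on (TopologicalSpace.denseRange_denseSeq unitInterval) w.1.continuous
    w'.1.continuous ?_
  rintro _ ⟨n, rfl⟩
  exact congrFun hw n

/-! ### The Gaussian structure of the Wiener measure -/

namespace IsWienerMeasure

variable {γ : Measure WienerSpace}

theorem path_zero (w : WienerSpace) : w.1 0 = 0 := w.2

theorem hasLaw_eval (hγ : IsWienerMeasure γ) (t : unitInterval) :
    HasLaw (fun w : WienerSpace => w.1 t) (gaussianReal 0 (Real.toNNReal t)) γ := by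
  simpa [path_zero] using hγ.law 0 t t.2.1

theorem isGaussianProcess (hγ : IsWienerMeasure γ) :
    IsGaussianProcess (fun (t : unitInterval) (w : WienerSpace) => w.1 t) γ :=
  hγ.indep.isGaussianProcess (fun t => (hγ.hasLaw_eval t).hasGaussianLaw)
    (ae_of_all _ fun w => w.2)

theorem memLp_eval (hγ : IsWienerMeasure γ) (t : unitInterval) :
    MemLp (fun w : WienerSpace => w.1 t) 2 γ :=
  (hγ.isGaussianProcess.hasGaussianLaw_eval t).memLp_two

theorem covariance_eval (hγ : IsWienerMeasure γ) (s t : unitInterval) :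
    cov[fun w : WienerSpace => w.1 s, fun w => w.1 t; γ] = min (s : ℝ) t := by
  have := hγ.isProbabilityMeasure
  wlog hst : s ≤ t generalizing s t
  · rw [covariance_comm, min_comm]
    exact this t s (le_of_not_ge hst)
  have h1 : cov[fun w : WienerSpace => w.1 s, fun w => w.1 t - w.1 s; γ] = 0 :=
    (hγ.indep.indepFun_eval_sub s.2.1 hst (ae_of_all _ fun w => w.2)).covariance_eq_zero
      (hγ.memLp_eval s) ((hγ.memLp_eval t).sub (hγ.memLp_eval s))
  rw [covariance_fun_sub_right (hγ.memLp_eval s) (hγ.memLp_eval t) (hγ.memLp_eval s)] at h1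
  have h2 : cov[fun w : WienerSpace => w.1 s, fun w => w.1 s; γ] = s := by
    rw [covariance_self (hγ.memLp_eval s).aemeasurable, (hγ.hasLaw_eval s).variance_eq,
      variance_id_gaussianReal, Real.coe_toNNReal _ s.2.1]
  rw [min_eq_left (by exact_mod_cast hst)]
  linarith

theorem hasLaw_wienerIntegral_sigma (hγ : IsWienerMeasure γ) {s k : ℕ} (hk : 1 ≤ k)
    (hk' : k ≤ 2 ^ s) : HasLaw (wienerIntegral (sigma s k)) (gaussianReal 0 1) γ := by
  have h0 := dyadic_left_nonneg (s := s) hk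
  have h1 := dyadic_le s k
  have h2 := dyadic_right_le_one hk'
  have h := gaussianReal_const_mul (hγ.law ⟨_, h0, h1.trans h2⟩ ⟨_, h0.trans h1, h2⟩ h1)
    ((2 : ℝ) ^ ((s : ℝ) / 2))
  have hx : wienerIntegral (sigma s k) = fun w => (2 : ℝ) ^ ((s : ℝ) / 2) *
      (w.1 ⟨_, h0.trans h1, h2⟩ - w.1 ⟨_, h0, h1.trans h2⟩) := by
    funext w
    rw [wienerIntegral_sigma hk hk', ← pathAt_coe, ← pathAt_coe]
  rw [hx]
  convert h using 2
  · simp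
  · refine NNReal.coe_injective ?_
    have : (k : ℝ) / 2 ^ s - (k - 1) / 2 ^ s = 1 / 2 ^ s := by ring
    simp only [NNReal.coe_mul, NNReal.coe_mk, NNReal.coe_one, this]
    rw [Real.coe_toNNReal _ (by positivity), sq, sqrt_two_pow_sq]
    field_simp

/-- The component of a path orthogonal to `sigma s k` is independent of `[sigma s k]`. -/
theorem indepFun_wienerIntegral_sigma (hγ : IsWienerMeasure γ) {s k : ℕ} (hk : 1 ≤ k)
    (hk' : k ≤ 2 ^ s) :
    IndepFun (wienerIntegral (sigma s k))
      (fun w => w - wienerIntegral (sigma s k) w • sigma s k) γ := by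
  have := hγ.isProbabilityMeasure
  have h0 := dyadic_left_nonneg (s := s) hk
  have h1 := dyadic_le s k
  have h2 := dyadic_right_le_one hk'
  set a : unitInterval := ⟨_, h0, h1.trans h2⟩ with ha
  set b : unitInterval := ⟨_, h0.trans h1, h2⟩ with hb
  set c : ℝ := (2 : ℝ) ^ ((s : ℝ) / 2) with hc
  have hx : wienerIntegral (sigma s k) = fun w => c * (w.1 b - w.1 a) := by
    funext w
    rw [wienerIntegral_sigma hk hk', ← pathAt_coe, ← pathAt_coe]
  have hLa := hγ.memLp_eval a
  have hLb := hγ.memLp_eval b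
  have hLx : MemLp (wienerIntegral (sigma s k)) 2 γ := by
    rw [hx]
    exact (hLb.sub hLa).const_mul c
  -- Reproducing property: the covariance of `[σ_k]` with `w(t)` is `σ_k(t)`, which is why
  -- subtracting `[σ_k] σ_k` decorrelates.
  have hcovx : ∀ t : unitInterval,
      cov[wienerIntegral (sigma s k), fun w => w.1 t; γ] = (sigma s k).1 t := by
    intro t
    rw [hx, covariance_const_mul_left, covariance_fun_sub_left hLb hLa (hγ.memLp_eval t),
      hγ.covariance_eval, hγ.covariance_eval, ← pathAt_coe, pathAt_sigma hk t.2]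
  have hvar : cov[wienerIntegral (sigma s k), wienerIntegral (sigma s k); γ] = 1 := by
    rw [covariance_self hLx.aemeasurable, (hγ.hasLaw_wienerIntegral_sigma hk hk').variance_eq,
      variance_id_gaussianReal, NNReal.coe_one]
  -- All the variables are linear in finitely many coordinates, hence jointly Gaussian, and zero
  -- covariance will give independence.
  have hG : IsGaussianProcess (Sum.elim (fun (_ : Unit) => wienerIntegral (sigma s k))
      (fun (t : unitInterval) (w : WienerSpace) =>
        w.1 t - wienerIntegral (sigma s k) w * (sigma s k).1 t)) γ := by
    classical
    refine hγ.isGaussianProcess.of_isGaussianProcess ?_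
    rintro (_ | t)
    · refine ⟨{a, b}, c • (ContinuousLinearMap.proj ⟨b, by simp⟩
        - ContinuousLinearMap.proj ⟨a, by simp⟩), fun w => ?_⟩
      simp [hx, Finset.restrict_def]
    · refine ⟨{a, b, t}, ContinuousLinearMap.proj ⟨t, by simp⟩
        - (c * (sigma s k).1 t) • (ContinuousLinearMap.proj ⟨b, by simp⟩
        - ContinuousLinearMap.proj ⟨a, by simp⟩), fun w => ?_⟩
      simp [hx, Finset.restrict_def]
      ring
  have hind := hG.indepFun_of_covariance_eq_zero (fun _ => hLx.aemeasurable)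
    (fun t => ((hγ.memLp_eval t).sub (hLx.mul_const _)).aemeasurable) (by
      intro _ t
      rw [covariance_fun_sub_right hLx (hγ.memLp_eval t) (hLx.mul_const _),
        covariance_mul_const_right, hcovx, hvar, one_mul, sub_self])
  have hφ : Measurable fun f : Unit → ℝ => f () := measurable_pi_apply _
  -- Independence holds for the product σ-field on all times; countably many dense times already
  -- generate the Borel σ-field of paths.
  have hψ : Measurable fun (f : unitInterval → ℝ) (n : ℕ) =>
      f (TopologicalSpace.denseSeq _ n) :=
    measurable_pi_lambda _ fun n => measurable_pi_apply _
  have hind' := hind.comp hφ hψ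
  rw [IndepFun_iff_Indep] at hind' ⊢
  have hcomap := congrArg (MeasurableSpace.comap
    fun w => w - wienerIntegral (sigma s k) w • sigma s k) measurableEmbedding_eval.comap_eq
  rw [MeasurableSpace.comap_comp] at hcomap
  rw [← hcomap]
  exact hind'

end IsWienerMeasure

/-! ### The Girsanov transformation along one direction -/

/-- The factor is the ratio of the Gaussian densities with means `c` and `0`. -/
theorem lintegral_gaussianReal_add (g : ℝ → ENNReal) (hg : Measurable g) (c : ℝ) :
    ∫⁻ x, g (x + c) ∂(gaussianReal 0 1) =
      ∫⁻ x, g x * ENNReal.ofReal (Real.exp (c * x - c ^ 2 / 2)) ∂(gaussianReal 0 1) := by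
  have hm : ∫⁻ x, g (x + c) ∂(gaussianReal 0 1) = ∫⁻ x, g x ∂(gaussianReal c 1) := by
    rw [← lintegral_map (f := g) hg (measurable_add_const c), gaussianReal_map_add_const, zero_add]
  rw [hm, gaussianReal_of_var_ne_zero _ one_ne_zero, gaussianReal_of_var_ne_zero _ one_ne_zero,
    lintegral_withDensity_eq_lintegral_mul _ (measurable_gaussianPDF _ _) hg,
    lintegral_withDensity_eq_lintegral_mul _ (measurable_gaussianPDF _ _)
      (g := fun x => g x * ENNReal.ofReal (Real.exp (c * x - c ^ 2 / 2)))
      (hg.mul (by fun_prop))]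
  refine lintegral_congr fun x => ?_
  have hpdf : gaussianPDF c 1 x =
      gaussianPDF 0 1 x * ENNReal.ofReal (Real.exp (c * x - c ^ 2 / 2)) := by
    rw [gaussianPDF, gaussianPDF, ← ENNReal.ofReal_mul (gaussianPDFReal_nonneg _ _ _),
      gaussianPDFReal, gaussianPDFReal,
      mul_assoc (√_)⁻¹, ← Real.exp_add]
    congr 3
    simp
    ring
  simp only [Pi.mul_apply, hpdf]
  ring

/-- Disintegrate `w = Y + X σ_k` with `X = [σ_k]` independent of `Y`. By invariance `ζ` is a
function of `Y`, so for fixed `Y` the translation shifts the Gaussian variable `X` by a constant. -/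
theorem lintegral_add_smul_sigma {γ : Measure WienerSpace} (hγ : IsWienerMeasure γ) {s k : ℕ}
    (hk : 1 ≤ k) (hk' : k ≤ 2 ^ s) {ζ : WienerSpace → ℝ} (hζ : Measurable ζ)
    (hζi : InvariantAlong (sigma s k) ζ) {Ψ : WienerSpace → ENNReal} (hΨ : Measurable Ψ) :
    ∫⁻ w, Ψ (w + ζ w • sigma s k) ∂γ = ∫⁻ w, Ψ w *
      ENNReal.ofReal (Real.exp (ζ w * wienerIntegral (sigma s k) w - ζ w ^ 2 / 2)) ∂γ := by
  have := hγ.isProbabilityMeasure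
  set θ := sigma s k with hθ
  set X := wienerIntegral θ with hX
  have hXm : Measurable X := measurable_wienerIntegral θ
  set Y : WienerSpace → WienerSpace := fun w => w - X w • θ with hY
  have hYm : Measurable Y := measurable_id.sub (hXm.smul_const θ)
  have hYw : ∀ w, Y w + X w • θ = w := fun w => sub_add_cancel _ _
  have hζY : ∀ w, ζ (Y w) = ζ w := fun w => by rw [← hζi (Y w) (X w), hYw]
  have hprod : γ.map (fun w => (Y w, X w)) = (γ.map Y).prod (gaussianReal 0 1) := by
    rw [(hγ.indepFun_wienerIntegral_sigma hk hk').symm.map_prod_eq_prod_map_map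
      hYm.aemeasurable hXm.aemeasurable, (hγ.hasLaw_wienerIntegral_sigma hk hk').map_eq]
  have hdis : ∀ H : WienerSpace × ℝ → ENNReal, Measurable H →
      ∫⁻ w, H (Y w, X w) ∂γ = ∫⁻ y, ∫⁻ x, H (y, x) ∂(gaussianReal 0 1) ∂(γ.map Y) := by
    intro H hH
    rw [← lintegral_prod _ hH.aemeasurable, ← hprod, lintegral_map hH (hYm.prodMk hXm)]
  have hline : Measurable fun p : WienerSpace × ℝ => p.1 + p.2 • θ :=
    measurable_fst.add (measurable_snd.smul_const θ)
  have hL := hdis (fun p => Ψ (p.1 + (p.2 + ζ p.1) • θ)) (hΨ.comp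
    (measurable_fst.add ((measurable_snd.add (hζ.comp measurable_fst)).smul_const θ)))
  have hR := hdis (fun p => Ψ (p.1 + p.2 • θ) *
    ENNReal.ofReal (Real.exp (ζ p.1 * p.2 - ζ p.1 ^ 2 / 2))) (by
      refine (hΨ.comp hline).mul ?_
      have : Measurable fun p : WienerSpace × ℝ => ζ p.1 := hζ.comp measurable_fst
      fun_prop)
  simp only [hζY, hYw, add_smul, ← add_assoc] at hL hR
  rw [hL, hR]
  refine lintegral_congr fun y => ?_
  have := lintegral_gaussianReal_add (fun x => Ψ (y + x • θ))
    (hΨ.comp (measurable_const.add (measurable_id.smul_const θ))) (ζ y)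
  simpa only [add_smul, ← add_assoc] using this

/-! ### Simple predictable processes -/

theorem stepFun_mul_stepFun (s k l : ℕ) (t : ℝ) :
    stepFun (((k : ℝ) - 1) / 2 ^ s) ((k : ℝ) / 2 ^ s) t *
      stepFun (((l : ℝ) - 1) / 2 ^ s) ((l : ℝ) / 2 ^ s) t =
      if k = l then stepFun (((k : ℝ) - 1) / 2 ^ s) ((k : ℝ) / 2 ^ s) t else 0 := by
  have hlt : ∀ k l : ℕ, k < l → ((k : ℝ) / 2 ^ s) ≤ ((l : ℝ) - 1) / 2 ^ s := by
    intro k l hkl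
    have : (k : ℝ) + 1 ≤ l := by exact_mod_cast hkl
    gcongr
    linarith
  split_ifs with h
  · subst h
    by_cases ht : t ∈ Set.Ioc (((k : ℝ) - 1) / 2 ^ s) ((k : ℝ) / 2 ^ s) <;> simp [stepFun, ht]
  · rw [stepFun, stepFun, ← Set.inter_indicator_mul]
    refine Set.indicator_of_notMem ?_ _
    rintro ⟨h1, h2⟩
    rcases lt_or_gt_of_ne h with hkl | hkl
    · exact absurd (h1.2.trans (hlt k l hkl)) (not_le.2 h2.1)
    · exact absurd (h2.2.trans (hlt l k hkl)) (not_le.2 h1.1)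

/-- Cross terms vanish because the half-open dyadic intervals are disjoint. -/
theorem simpleProcess_sq (s : ℕ) (z : ℕ → WienerSpace → ℝ) (w : WienerSpace) (t : ℝ) :
    simpleProcess s z w t ^ 2 = ∑ k ∈ Finset.Icc 1 (2 ^ s),
      2 ^ s * z k w ^ 2 * stepFun (((k : ℝ) - 1) / 2 ^ s) ((k : ℝ) / 2 ^ s) t := by
  rw [simpleProcess, sq, Finset.sum_mul_sum]
  refine Finset.sum_congr rfl fun k hk => ?_
  have : ∀ l ∈ Finset.Icc 1 (2 ^ s),
      (2 : ℝ) ^ ((s : ℝ) / 2) * z k w * stepFun (((k : ℝ) - 1) / 2 ^ s) ((k : ℝ) / 2 ^ s) t *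
        ((2 : ℝ) ^ ((s : ℝ) / 2) * z l w * stepFun (((l : ℝ) - 1) / 2 ^ s) ((l : ℝ) / 2 ^ s) t)
      = if k = l then
        2 ^ s * z k w ^ 2 * stepFun (((k : ℝ) - 1) / 2 ^ s) ((k : ℝ) / 2 ^ s) t else 0 := by
    intro l _
    have h1 := stepFun_mul_stepFun s k l t
    have h2 := sqrt_two_pow_sq s
    split_ifs at h1 ⊢ with h
    · subst h
      linear_combination ((2 : ℝ) ^ ((s : ℝ) / 2)) ^ 2 * z k w ^ 2 * h1 +
        z k w ^ 2 * stepFun (((k : ℝ) - 1) / 2 ^ s) ((k : ℝ) / 2 ^ s) t * h2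
    · linear_combination ((2 : ℝ) ^ ((s : ℝ) / 2)) ^ 2 * z k w * z l w * h1
  rw [Finset.sum_congr rfl this, Finset.sum_ite_eq, if_pos hk]

theorem integral_simpleProcess_sq (s : ℕ) (z : ℕ → WienerSpace → ℝ) (w : WienerSpace) :
    ∫ t in (0 : ℝ)..1, simpleProcess s z w t ^ 2 = ∑ k ∈ Finset.Icc 1 (2 ^ s), z k w ^ 2 := by
  simp only [simpleProcess_sq]
  rw [intervalIntegral.integral_finsetSum fun k _ =>
    ((integrable_stepFun _ _).const_mul _).intervalIntegrable]
  refine Finset.sum_congr rfl fun k hk => ?_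
  obtain ⟨hk, hk'⟩ := Finset.mem_Icc.1 hk
  have h2 := dyadic_right_le_one hk'
  rw [intervalIntegral.integral_const_mul,
    integral_stepFun (dyadic_left_nonneg hk) (dyadic_le s k) zero_le_one, min_eq_left h2,
    min_eq_left ((dyadic_le s k).trans h2)]
  field_simp
  ring

theorem drift_eq_sum (s : ℕ) (z : ℕ → WienerSpace → ℝ) (w : WienerSpace) :
    drift s z w = ∑ k ∈ Finset.Icc 1 (2 ^ s), z k w • sigma s k := by
  refine Subtype.ext (ContinuousMap.ext fun u => ?_)
  have h : (∑ k ∈ Finset.Icc 1 (2 ^ s), z k w • sigma s k).1 u =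
      ∑ k ∈ Finset.Icc 1 (2 ^ s), z k w * ∫ t in (0 : ℝ)..u, sigmaDot s k t := by
    rw [AddSubmonoidClass.coe_finsetSum, ContinuousMap.sum_apply]
    rfl
  rw [h]
  show ∫ t in (0 : ℝ)..u, simpleProcess s z w t = _
  simp only [simpleProcess, sigmaDot]
  rw [intervalIntegral.integral_finsetSum fun k _ =>
    ((integrable_stepFun _ _).const_mul _).intervalIntegrable]
  refine Finset.sum_congr rfl fun k _ => ?_
  rw [intervalIntegral.integral_const_mul, intervalIntegral.integral_const_mul]
  ring

/-! ### Composition of the exponentials and the main theorem -/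

variable {s : ℕ} {z : ℕ → WienerSpace → ℝ}

theorem IsSimplePredictable.invariantAlong (hz : IsSimplePredictable s z) {k m : ℕ} (hk : 1 ≤ k)
    (hk' : k ≤ 2 ^ s) (hkm : k ≤ m) : InvariantAlong (sigma s m) (z k) :=
  invariantAlong_sigma hk hkm (hz k hk hk')

theorem IsSimplePredictable.measurable (hz : IsSimplePredictable s z) {k : ℕ} (hk : 1 ≤ k)
    (hk' : k ≤ 2 ^ s) : Measurable (z k) :=
  (hz k hk hk').mono (pathFiltration_le _) le_rfl

theorem expChain_eq (hz : IsSimplePredictable s z) {F : WienerSpace → ℝ}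
    (hF : ∀ k, 1 ≤ k → k ≤ 2 ^ s → PolynomialAlong (sigma s k) F) (m : ℕ) (hm : m ≤ 2 ^ s) :
    (∀ l < m, InExpDomain (sigma s (l + 1)) (opD s z (l + 1)) (expChain s z F l)) ∧
      ∀ w, expChain s z F m w = F (w + ∑ k ∈ Finset.Icc 1 m, z k w • sigma s k) := by
  induction m with
  | zero => simp [expChain]
  | succ m ih =>
    obtain ⟨hdom, heq⟩ := ih (Nat.le_of_succ_le hm)
    have hshift : ∀ (w : WienerSpace) (ε : ℝ), expChain s z F m (w + ε • sigma s (m + 1)) =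
        F ((w + ∑ k ∈ Finset.Icc 1 m, z k w • sigma s k) + ε • sigma s (m + 1)) := by
      intro w ε
      -- Predictability enters here: `z_1, …, z_m` do not feel a translation along `sigma s (m +
      -- 1)`.
      have hsum : ∑ k ∈ Finset.Icc 1 m, z k (w + ε • sigma s (m + 1)) • sigma s k =
          ∑ k ∈ Finset.Icc 1 m, z k w • sigma s k := by
        refine Finset.sum_congr rfl fun k hk => ?_
        obtain ⟨hk1, hk2⟩ := Finset.mem_Icc.1 hk
        rw [hz.invariantAlong hk1 (by omega) (by omega) w ε]
      rw [heq, hsum, add_right_comm]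
    have hpoly : PolynomialAlong (sigma s (m + 1)) (expChain s z F m) := by
      intro w
      obtain ⟨q, hq⟩ := hF (m + 1) (by omega) hm (w + ∑ k ∈ Finset.Icc 1 m, z k w • sigma s k)
      exact ⟨q, fun ε => (hshift w ε).trans (hq ε)⟩
    obtain ⟨h1, h2⟩ := expOp_opD (hz.invariantAlong (by omega) hm le_rfl) hpoly
    refine ⟨fun l hl => ?_, fun w => ?_⟩
    · rcases Nat.lt_succ_iff_lt_or_eq.1 hl with hl | rfl
      · exact hdom l hl
      · exact h1
    · rw [expChain, h2, hshift, add_assoc, ← Finset.sum_Icc_succ_top (by omega)]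

theorem expStarChain_eq (hz : IsSimplePredictable s z) (m : ℕ) (hm : m ≤ 2 ^ s) :
    (∀ l < m, InExpDomain (sigma s (l + 1)) (opDstar s z (l + 1))
      (expStarChain s z (fun _ => 1) l)) ∧
      ∀ w, expStarChain s z (fun _ => 1) m w = Real.exp (∑ k ∈ Finset.Icc 1 m,
        (z k w * wienerIntegral (sigma s k) w - z k w ^ 2 / 2)) := by
  induction m with
  | zero => simp [expStarChain]
  | succ m ih =>
    obtain ⟨hdom, heq⟩ := ih (Nat.le_of_succ_le hm)
    have hinv : InvariantAlong (sigma s (m + 1)) (expStarChain s z (fun _ => 1) m) := by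
      intro w ε
      rw [heq, heq]
      congr 1
      refine Finset.sum_congr rfl fun k hk => ?_
      obtain ⟨hk1, hk2⟩ := Finset.mem_Icc.1 hk
      have hkm : (k : ℝ) ≤ ((m + 1 : ℕ) : ℝ) - 1 := by
        push_cast
        rw [add_sub_cancel_right]
        exact_mod_cast hk2
      -- The increments in `[σ_k]`, `k ≤ m`, end by time `m / 2^s`, before `sigma s (m + 1)` starts
      -- to grow.
      have hzero : ∀ t ∈ Set.Icc (0 : ℝ) 1, t ≤ (k : ℝ) / 2 ^ s →
          pathAt (sigma s (m + 1)) t = 0 := by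
        intro t ht htk
        exact (pathAt_coe _ ⟨t, ht⟩).trans
          (sigma_eq_zero (by omega) ⟨t, ht⟩ (htk.trans (by gcongr)))
      have h0 := dyadic_left_nonneg (s := s) hk1
      have h1 := dyadic_le s k
      have h2 := dyadic_right_le_one (s := s) (k := k) (by omega)
      rw [hz.invariantAlong hk1 (by omega) (by omega) w ε, wienerIntegral_sigma hk1 (by omega),
        wienerIntegral_sigma hk1 (by omega), pathAt_add_smul, pathAt_add_smul,
        hzero _ ⟨h0, h1.trans h2⟩ h1, hzero _ ⟨h0.trans h1, h2⟩ le_rfl, mul_zero, add_zero,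
        add_zero]
    obtain ⟨h1, h2⟩ := expOp_opDstar (by omega) hm
      (hz.invariantAlong (by omega) hm le_rfl) hinv
    refine ⟨fun l hl => ?_, fun w => ?_⟩
    · rcases Nat.lt_succ_iff_lt_or_eq.1 hl with hl | rfl
      · exact hdom l hl
      · exact h1
    · rw [expStarChain, h2, heq, ← Real.exp_add, ← Finset.sum_Icc_succ_top (by omega)]

/-- Two measurable functions whose positive parts have the same integral, and whose negative parts
have the same integral, are integrable at the same time and have the same integral. -/
theorem integrable_iff_and_integral_eq_of_lintegral {α : Type*} [MeasurableSpace α]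
    {μ : Measure α} {f g : α → ℝ} (hf : Measurable f) (hg : Measurable g)
    (hpos : ∫⁻ x, ENNReal.ofReal (f x) ∂μ = ∫⁻ x, ENNReal.ofReal (g x) ∂μ)
    (hneg : ∫⁻ x, ENNReal.ofReal (-f x) ∂μ = ∫⁻ x, ENNReal.ofReal (-g x) ∂μ) :
    (Integrable f μ ↔ Integrable g μ) ∧ ∫ x, f x ∂μ = ∫ x, g x ∂μ := by
  have habs : ∀ h : α → ℝ, Measurable h → ∫⁻ x, ‖h x‖ₑ ∂μ =
      ∫⁻ x, ENNReal.ofReal (h x) ∂μ + ∫⁻ x, ENNReal.ofReal (-h x) ∂μ := by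
    intro h hh
    rw [← lintegral_add_left hh.ennreal_ofReal]
    refine lintegral_congr fun x => ?_
    rw [← ofReal_norm, Real.norm_eq_abs]
    rcases le_total 0 (h x) with hx | hx
    · rw [abs_of_nonneg hx, ENNReal.ofReal_of_nonpos (neg_nonpos.2 hx), add_zero]
    · rw [abs_of_nonpos hx, ENNReal.ofReal_of_nonpos hx, zero_add]
  have hiff : Integrable f μ ↔ Integrable g μ := by
    simp only [Integrable, hf.aestronglyMeasurable, hg.aestronglyMeasurable, true_and,
      HasFiniteIntegral, habs f hf, habs g hg, hpos, hneg]
  refine ⟨hiff, ?_⟩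
  by_cases hfi : Integrable f μ
  · rw [integral_eq_lintegral_pos_part_sub_lintegral_neg_part hfi,
      integral_eq_lintegral_pos_part_sub_lintegral_neg_part (hiff.1 hfi), hpos, hneg]
  -- Without integrability both Bochner integrals take the default value `0`.
  · rw [integral_undef hfi, integral_undef (mt hiff.2 hfi)]

theorem mainTheorem5 (γ : Measure WienerSpace) (hγ : IsWienerMeasure γ)
    (s : ℕ) (z : ℕ → WienerSpace → ℝ) (hz : IsSimplePredictable s z) :
    -- (i)
    (∀ F ∈ polyPH,
      (∀ m < 2 ^ s, InExpDomain (sigma s (m + 1)) (opD s z (m + 1)) (expChain s z F m)) ∧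
      ∀ w, expChain s z F (2 ^ s) w = F (w + drift s z w)) ∧
    -- (ii), first part
    (∀ k : ℕ, 1 ≤ k → k ≤ 2 ^ s → ∀ F : WienerSpace → ℝ,
      Measurable[pathFiltration (((k : ℝ) - 1) / 2 ^ s)] F →
      InExpDomain (sigma s k) (opDstar s z k) F ∧
      ∀ w, expOp (opDstar s z k) F w = F w * expOp (opDstar s z k) (fun _ => 1) w) ∧
    -- (ii), second part
    ((∀ m < 2 ^ s, InExpDomain (sigma s (m + 1)) (opDstar s z (m + 1))
        (expStarChain s z (fun _ => 1) m)) ∧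
      ∀ w, expStarChain s z (fun _ => 1) (2 ^ s) w =
        Real.exp (stochasticIntegral s z w
          - (1 / 2) * ∫ t in (0 : ℝ)..1, (simpleProcess s z w t) ^ 2)) ∧
    -- (iii): the expectations agree, also as extended ones (through positive and negative parts)
    (∀ k : ℕ, 1 ≤ k → k ≤ 2 ^ s → ∀ F ∈ polyP, ∀ G : WienerSpace → ℝ,
      Measurable[pathFiltration (((k : ℝ) - 1) / 2 ^ s)] G → Integrable G γ →
      InExpDomain (sigma s k) (opD s z k) F ∧
      InExpDomain (sigma s k) (opDstar s z k) G ∧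
      ∫⁻ w, ENNReal.ofReal (expOp (opD s z k) F w * G w) ∂γ =
        ∫⁻ w, ENNReal.ofReal (F w * expOp (opDstar s z k) G w) ∂γ ∧
      ∫⁻ w, ENNReal.ofReal (-(expOp (opD s z k) F w * G w)) ∂γ =
        ∫⁻ w, ENNReal.ofReal (-(F w * expOp (opDstar s z k) G w)) ∂γ ∧
      (Integrable (fun w => expOp (opD s z k) F w * G w) γ ↔
        Integrable (fun w => F w * expOp (opDstar s z k) G w) γ) ∧
      ∫ w, expOp (opD s z k) F w * G w ∂γ = ∫ w, F w * expOp (opDstar s z k) G w ∂γ) := by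
  have hpoly : ∀ {S : Set WienerSpace} {F : WienerSpace → ℝ}, F ∈ polynomialFunctionals S →
      ∀ k, 1 ≤ k → k ≤ 2 ^ s → PolynomialAlong (sigma s k) F :=
    fun hF _ hk hk' => polynomialAlong_of_mem hF hk hk'
  refine ⟨fun F hF => ?_, fun k hk hk' F hF => ?_, ?_, fun k hk hk' F hF G hG hGi => ?_⟩
  · obtain ⟨h1, h2⟩ := expChain_eq hz (hpoly hF) (2 ^ s) le_rfl
    exact ⟨h1, fun w => by rw [h2, drift_eq_sum]⟩
  · have hzi := hz.invariantAlong hk hk' le_rfl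
    obtain ⟨h1, h2⟩ := expOp_opDstar hk hk' hzi (invariantAlong_sigma hk le_rfl hF)
    obtain ⟨-, h3⟩ := expOp_opDstar hk hk' hzi (F := fun _ => 1) fun _ _ => rfl
    exact ⟨h1, fun w => by rw [h2, h3, one_mul]⟩
  · obtain ⟨h1, h2⟩ := expStarChain_eq hz (2 ^ s) le_rfl
    refine ⟨h1, fun w => ?_⟩
    rw [h2, integral_simpleProcess_sq, stochasticIntegral, Finset.mul_sum,
      ← Finset.sum_sub_distrib]
    congr 1
    refine Finset.sum_congr rfl fun k hk => ?_
    obtain ⟨hk, hk'⟩ := Finset.mem_Icc.1 hk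
    rw [wienerIntegral_sigma hk hk']
    ring
  · have hzi := hz.invariantAlong hk hk' le_rfl
    have hGinv := invariantAlong_sigma (m := k) hk le_rfl hG
    obtain ⟨h1, h2⟩ := expOp_opD hzi (hpoly hF k hk hk')
    obtain ⟨h3, h4⟩ := expOp_opDstar hk hk' hzi hGinv
    have hzm := hz.measurable hk hk'
    have hFm := measurable_of_mem_polynomialFunctionals hF
    have hGm : Measurable G := hG.mono (pathFiltration_le _) le_rfl
    have hXm := measurable_wienerIntegral (sigma s k)
    -- `G` is invariant along `sigma s k`, so it may be translated too; the integrand becomes `F *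
    -- G` at the translated path.
    have hl : (fun w => expOp (opD s z k) F w * G w) = fun w =>
        F (w + z k w • sigma s k) * G (w + z k w • sigma s k) := by
      funext w
      rw [h2, hGinv]
    have hr : (fun w => F w * expOp (opDstar s z k) G w) = fun w => F w * G w *
        Real.exp (z k w * wienerIntegral (sigma s k) w - z k w ^ 2 / 2) := by
      funext w
      rw [h4, mul_assoc]
    have hpos : ∫⁻ w, ENNReal.ofReal (expOp (opD s z k) F w * G w) ∂γ =
        ∫⁻ w, ENNReal.ofReal (F w * expOp (opDstar s z k) G w) ∂γ := by
      simp only [congrFun hl, congrFun hr, ENNReal.ofReal_mul' (Real.exp_nonneg _)]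
      exact lintegral_add_smul_sigma hγ hk hk' hzm hzi (hFm.mul hGm).ennreal_ofReal
    have hneg : ∫⁻ w, ENNReal.ofReal (-(expOp (opD s z k) F w * G w)) ∂γ =
        ∫⁻ w, ENNReal.ofReal (-(F w * expOp (opDstar s z k) G w)) ∂γ := by
      simp only [congrFun hl, congrFun hr, ← neg_mul, ENNReal.ofReal_mul' (Real.exp_nonneg _)]
      exact lintegral_add_smul_sigma hγ hk hk' hzm hzi (hFm.neg.mul hGm).ennreal_ofReal
    have hshift : Measurable fun w => w + z k w • sigma s k :=
      measurable_id.add (hzm.smul_const _)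
    have hlm : Measurable fun w => expOp (opD s z k) F w * G w := by
      rw [hl]
      exact (hFm.comp hshift).mul (hGm.comp hshift)
    have hrm : Measurable fun w => F w * expOp (opDstar s z k) G w := by
      rw [hr]
      fun_prop
    exact ⟨h1, h3, hpos, hneg, integrable_iff_and_integral_eq_of_lintegral hlm hrm hpos hneg⟩
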